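/- Let $X$ and $Y$ be Banach spaces over the same field $\mathbb K\in\{\mathbb R,\mathbb C\}$. A bounded operator $T:X\to Y$ is nuclear if there are bounded sequences $(x_n^*)\subseteq X^*$ and $(y_n)\subseteq Y$ with $\sum_{n=1}^\infty\|x_n^*\|\|y_n\|<\infty$ and $T(x)=\sum_{n=1}^\infty x_n^*(x)y_n$ for all $x\in X$. The space $\mathcal N(X,Y)$ of nuclear operators is normed by the nuclear norm $\|T\|_N$, the infimum of $\sum_n\|x_n^*\|\|y_n\|$ over all such representations of $T$. The operator $T\in\mathcal N(X,Y)$ attains its nuclear norm if some such representation satisfies $\|T\|_N=\sum_n\|x_n^*\|\|y_n\|$; let $\operatorname{NA}_{\mathcal N}(X,Y)$ be the set of all such $T$. A Banach space $Z$ has the metric $\pi$-property if for every $\varepsilon>0$ and all $z_1,\dots,z_n$ in the unit sphere of $Z$ there is a finite dimensional subspace $M\subseteq Z$ that is $1$-complemented (there is a linear projection of $Z$ onto $M$ of norm at most $1$) and contains $z_1',\dots,z_n'$ with $\|z_i-z_i'\|<\varepsilon$ for every $i$. Suppose that $X^*$ has the metric $\pi$-property. (a) If $Y$ has the metric $\pi$-property,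 then $\overline{\operatorname{NA}_{\mathcal N}(X,Y)}^{\|\cdot\|_N}=\mathcal N(X,Y)$. (b) If $Y$ is uniformly convex, then $\overline{\operatorname{NA}_{\mathcal N}(X,Y)}^{\|\cdot\|_N}=\mathcal N(X,Y)$. -/

import Mathlib

/-- `M` is a `1`-complemented subspace of `E`: it is the range of a linear projection of `E` of
norm at most one (norm exactly one unless `M = 0`). -/
def IsOneComplemented {𝕜 E : Type*} [RCLike 𝕜] [NormedAddCommGroup E] [NormedSpace 𝕜 E]
    (M : Submodule 𝕜 E) : Prop :=
  ∃ P : E →L[𝕜] E, ‖P‖ ≤ 1 ∧ (∀ x, P x ∈ M) ∧ ∀ x ∈ M, P x = x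

/-- The metric `π`-property: finitely many points of the unit sphere can be approximated, up to any
`ε > 0`, from a single finite dimensional `1`-complemented subspace. -/
def MetricPiProperty (𝕜 E : Type*) [RCLike 𝕜] [NormedAddCommGroup E] [NormedSpace 𝕜 E] : Prop :=
  ∀ ε : ℝ, 0 < ε → ∀ F : Finset E, (∀ x ∈ F, ‖x‖ = 1) →
    ∃ M : Submodule 𝕜 E, FiniteDimensional 𝕜 M ∧ IsOneComplemented M ∧
      ∀ x ∈ F, ∃ x' ∈ M, ‖x - x'‖ < ε

/-- The bounded sequences `(f n)` in the dual of `X` and `(y n)` in `Y` form a nuclear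
representation `T = ∑ f n ⊗ y n`, with `∑ ‖f n‖ ‖y n‖ < ∞`. -/
structure IsNuclearRep {𝕜 X Y : Type*} [RCLike 𝕜] [NormedAddCommGroup X] [NormedSpace 𝕜 X]
    [NormedAddCommGroup Y] [NormedSpace 𝕜 Y] (T : X →L[𝕜] Y)
    (f : ℕ → StrongDual 𝕜 X) (y : ℕ → Y) : Prop where
  bounded_left : ∃ C : ℝ, ∀ n, ‖f n‖ ≤ C
  bounded_right : ∃ C : ℝ, ∀ n, ‖y n‖ ≤ C
  summable : Summable fun n => ‖f n‖ * ‖y n‖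
  hasSum : ∀ x, HasSum (fun n => f n x • y n) (T x)

namespace IsNuclearRep

variable {𝕜 X Y : Type*} [RCLike 𝕜] [NormedAddCommGroup X] [NormedSpace 𝕜 X]
  [NormedAddCommGroup Y] [NormedSpace 𝕜 Y]

theorem zero : IsNuclearRep (0 : X →L[𝕜] Y) (fun _ => 0) (fun _ => 0) where
  bounded_left := ⟨0, by simp⟩
  bounded_right := ⟨0, by simp⟩
  summable := by simp
  hasSum x := by simp

theorem smul {T : X →L[𝕜] Y} {f : ℕ → StrongDual 𝕜 X} {y : ℕ → Y} (h : IsNuclearRep T f y)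
    (c : 𝕜) : IsNuclearRep (c • T) (fun n => c • f n) y where
  bounded_left := by
    obtain ⟨C, hC⟩ := h.bounded_left
    exact ⟨‖c‖ * C, fun n => by rw [norm_smul]; gcongr; exact hC n⟩
  bounded_right := h.bounded_right
  summable := by simpa [norm_smul, mul_assoc] using h.summable.mul_left ‖c‖
  hasSum x := by simpa [mul_smul] using (h.hasSum x).const_smul c

theorem tsum_smul {f : ℕ → StrongDual 𝕜 X} {y : ℕ → Y} (c : 𝕜) :
    ∑' n, ‖c • f n‖ * ‖y n‖ = ‖c‖ * ∑' n, ‖f n‖ * ‖y n‖ := by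
  simp only [norm_smul, mul_assoc, tsum_mul_left]

/-- Two representations placed side by side represent the sum of the operators. -/
theorem add {T S : X →L[𝕜] Y} {f g : ℕ → StrongDual 𝕜 X} {y z : ℕ → Y}
    (hT : IsNuclearRep T f y) (hS : IsNuclearRep S g z) :
    ∃ (u : ℕ → StrongDual 𝕜 X) (v : ℕ → Y), IsNuclearRep (T + S) u v ∧
      ∑' n, ‖u n‖ * ‖v n‖ = ∑' n, ‖f n‖ * ‖y n‖ + ∑' n, ‖g n‖ * ‖z n‖ := by
  let e := Equiv.natSumNatEquivNat.symm
  let u : ℕ ⊕ ℕ → StrongDual 𝕜 X := Sum.elim f g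
  let v : ℕ ⊕ ℕ → Y := Sum.elim y z
  have hs : HasSum (fun i => ‖u i‖ * ‖v i‖)
      (∑' n, ‖f n‖ * ‖y n‖ + ∑' n, ‖g n‖ * ‖z n‖) :=
    HasSum.sum (f := fun i => ‖u i‖ * ‖v i‖) hT.summable.hasSum hS.summable.hasSum
  have hs' := (e.hasSum_iff).2 hs
  refine ⟨u ∘ e, v ∘ e, ⟨?_, ?_, hs'.summable, fun x => ?_⟩, hs'.tsum_eq⟩
  · obtain ⟨C, hC⟩ := hT.bounded_left
    obtain ⟨D, hD⟩ := hS.bounded_left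
    refine ⟨max C D, fun n => ?_⟩
    show ‖u (e n)‖ ≤ _
    rcases e n with m | m
    · exact (hC m).trans (le_max_left _ _)
    · exact (hD m).trans (le_max_right _ _)
  · obtain ⟨C, hC⟩ := hT.bounded_right
    obtain ⟨D, hD⟩ := hS.bounded_right
    refine ⟨max C D, fun n => ?_⟩
    show ‖v (e n)‖ ≤ _
    rcases e n with m | m
    · exact (hC m).trans (le_max_left _ _)
    · exact (hD m).trans (le_max_right _ _)
  · have hx : HasSum (fun i => u i x • v i) (T x + S x) :=
      HasSum.sum (f := fun i => u i x • v i) (hT.hasSum x) (hS.hasSum x)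
    have hx' := (e.hasSum_iff).2 hx
    exact hx'

theorem opNorm_le {T : X →L[𝕜] Y} {f : ℕ → StrongDual 𝕜 X} {y : ℕ → Y}
    (h : IsNuclearRep T f y) : ‖T‖ ≤ ∑' n, ‖f n‖ * ‖y n‖ := by
  refine T.opNorm_le_bound (tsum_nonneg fun n => by positivity) fun x => ?_
  have hb : ∀ n, ‖f n x • y n‖ ≤ ‖f n‖ * ‖y n‖ * ‖x‖ := fun n => by
    rw [norm_smul, mul_right_comm]
    gcongr
    exact (f n).le_opNorm x
  have hs := h.summable.hasSum.mul_right ‖x‖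
  exact (h.hasSum x).norm_le_of_bounded hs hb

end IsNuclearRep

/-- The set of values `∑ ‖f n‖ ‖y n‖` over all nuclear representations of `T`. -/
def nuclearRepValues {𝕜 X Y : Type*} [RCLike 𝕜] [NormedAddCommGroup X] [NormedSpace 𝕜 X]
    [NormedAddCommGroup Y] [NormedSpace 𝕜 Y] (T : X →L[𝕜] Y) : Set ℝ :=
  {s | ∃ (f : ℕ → StrongDual 𝕜 X) (y : ℕ → Y), IsNuclearRep T f y ∧ s = ∑' n, ‖f n‖ * ‖y n‖}

/-- The nuclear norm `‖T‖_N` (meaningful for nuclear `T`). -/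
noncomputable def nuclearNorm {𝕜 X Y : Type*} [RCLike 𝕜] [NormedAddCommGroup X] [NormedSpace 𝕜 X]
    [NormedAddCommGroup Y] [NormedSpace 𝕜 Y] (T : X →L[𝕜] Y) : ℝ :=
  sInf (nuclearRepValues T)

/-- The linear space of nuclear operators, as a subspace of the bounded operators. -/
def nuclearSubmodule (𝕜 X Y : Type*) [RCLike 𝕜] [NormedAddCommGroup X] [NormedSpace 𝕜 X]
    [NormedAddCommGroup Y] [NormedSpace 𝕜 Y] : Submodule 𝕜 (X →L[𝕜] Y) where
  carrier := {T | ∃ (f : ℕ → StrongDual 𝕜 X) (y : ℕ → Y), IsNuclearRep T f y}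
  zero_mem' := ⟨_, _, IsNuclearRep.zero⟩
  add_mem' := by
    rintro T S ⟨f, y, hT⟩ ⟨g, z, hS⟩
    obtain ⟨u, v, h, -⟩ := hT.add hS
    exact ⟨u, v, h⟩
  smul_mem' := by
    rintro c T ⟨f, y, hT⟩
    exact ⟨_, _, hT.smul c⟩

section nuclearNorm

variable {𝕜 X Y : Type*} [RCLike 𝕜] [NormedAddCommGroup X] [NormedSpace 𝕜 X]
  [NormedAddCommGroup Y] [NormedSpace 𝕜 Y]

theorem bddBelow_nuclearRepValues (T : X →L[𝕜] Y) : BddBelow (nuclearRepValues T) := by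
  refine ⟨0, ?_⟩
  rintro _ ⟨f, y, -, rfl⟩
  exact tsum_nonneg fun n => by positivity

theorem nuclearNorm_le {T : X →L[𝕜] Y} {f : ℕ → StrongDual 𝕜 X} {y : ℕ → Y}
    (h : IsNuclearRep T f y) : nuclearNorm T ≤ ∑' n, ‖f n‖ * ‖y n‖ :=
  csInf_le (bddBelow_nuclearRepValues T) ⟨f, y, h, rfl⟩

theorem le_nuclearNorm {T : X →L[𝕜] Y} (hT : T ∈ nuclearSubmodule 𝕜 X Y) {a : ℝ}
    (ha : ∀ (f : ℕ → StrongDual 𝕜 X) (y : ℕ → Y), IsNuclearRep T f y →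
      a ≤ ∑' n, ‖f n‖ * ‖y n‖) : a ≤ nuclearNorm T := by
  obtain ⟨f, y, h⟩ := hT
  refine le_csInf ⟨_, f, y, h, rfl⟩ ?_
  rintro _ ⟨g, z, hg, rfl⟩
  exact ha g z hg

theorem nuclearNorm_zero : nuclearNorm (0 : X →L[𝕜] Y) = 0 := by
  refine le_antisymm ((nuclearNorm_le IsNuclearRep.zero).trans (by simp)) ?_
  exact le_nuclearNorm (zero_mem _) fun f y _ => tsum_nonneg fun n => by positivity

theorem nuclearNorm_add_le {T S : X →L[𝕜] Y} (hT : T ∈ nuclearSubmodule 𝕜 X Y)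
    (hS : S ∈ nuclearSubmodule 𝕜 X Y) :
    nuclearNorm (T + S) ≤ nuclearNorm T + nuclearNorm S := by
  rw [← sub_le_iff_le_add]
  refine le_nuclearNorm hT fun f y hf => ?_
  rw [sub_le_iff_le_add, ← sub_le_iff_le_add']
  refine le_nuclearNorm hS fun g z hg => ?_
  rw [sub_le_iff_le_add']
  obtain ⟨u, v, h, huv⟩ := hf.add hg
  exact (nuclearNorm_le h).trans huv.le

theorem nuclearNorm_smul_le {T : X →L[𝕜] Y} (hT : T ∈ nuclearSubmodule 𝕜 X Y) (c : 𝕜) :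
    nuclearNorm (c • T) ≤ ‖c‖ * nuclearNorm T := by
  rcases eq_or_ne c 0 with rfl | hc
  · simp [nuclearNorm_zero]
  · have hc' : 0 < ‖c‖ := norm_pos_iff.2 hc
    rw [mul_comm, ← div_le_iff₀ hc']
    refine le_nuclearNorm hT fun f y hf => ?_
    rw [div_le_iff₀ hc', mul_comm, ← IsNuclearRep.tsum_smul]
    exact nuclearNorm_le (hf.smul c)

theorem opNorm_le_nuclearNorm {T : X →L[𝕜] Y} (hT : T ∈ nuclearSubmodule 𝕜 X Y) :
    ‖T‖ ≤ nuclearNorm T :=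
  le_nuclearNorm hT fun _ _ h => h.opNorm_le

end nuclearNorm

/-- The space `N(X, Y)` of nuclear operators. It is a type of its own, so that it carries the
nuclear norm and not the operator norm. -/
def NuclearOperator (𝕜 X Y : Type*) [RCLike 𝕜] [NormedAddCommGroup X] [NormedSpace 𝕜 X]
    [NormedAddCommGroup Y] [NormedSpace 𝕜 Y] : Type _ :=
  ↥(nuclearSubmodule 𝕜 X Y)

namespace NuclearOperator

variable {𝕜 X Y : Type*} [RCLike 𝕜] [NormedAddCommGroup X] [NormedSpace 𝕜 X]
  [NormedAddCommGroup Y] [NormedSpace 𝕜 Y]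

/-- The bounded operator underlying a nuclear operator. -/
def toCLM (T : NuclearOperator 𝕜 X Y) : X →L[𝕜] Y := T.1

instance : AddCommGroup (NuclearOperator 𝕜 X Y) :=
  inferInstanceAs (AddCommGroup ↥(nuclearSubmodule 𝕜 X Y))

instance : Module 𝕜 (NuclearOperator 𝕜 X Y) :=
  inferInstanceAs (Module 𝕜 ↥(nuclearSubmodule 𝕜 X Y))

/-- `N(X, Y)` is normed by the nuclear norm. -/
noncomputable instance : NormedAddCommGroup (NuclearOperator 𝕜 X Y) :=
  AddGroupNorm.toNormedAddCommGroup
    { toFun := fun T => nuclearNorm T.toCLM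
      map_zero' := nuclearNorm_zero
      add_le' := fun T S => nuclearNorm_add_le T.2 S.2
      neg' := fun T => by
        have key : ∀ S : NuclearOperator 𝕜 X Y,
            nuclearNorm (-S).toCLM ≤ nuclearNorm S.toCLM := fun S => by
          have h := nuclearNorm_smul_le S.2 (-1 : 𝕜)
          rw [norm_neg, norm_one, one_mul, neg_one_smul] at h
          exact h
        exact le_antisymm (key T) (by simpa using key (-T))
      eq_zero_of_map_eq_zero' := fun T hT => by
        have h : ‖T.1‖ ≤ 0 := (opNorm_le_nuclearNorm T.2).trans hT.le
        exact Subtype.ext (norm_le_zero_iff.1 h) }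

theorem norm_def (T : NuclearOperator 𝕜 X Y) : ‖T‖ = nuclearNorm T.toCLM := rfl

noncomputable instance : NormedSpace 𝕜 (NuclearOperator 𝕜 X Y) where
  norm_smul_le c T := nuclearNorm_smul_le T.2 c

/-- `T` attains its nuclear norm: the infimum defining `‖T‖_N` is attained at some nuclear
representation. -/
def AttainsNuclearNorm (T : NuclearOperator 𝕜 X Y) : Prop :=
  ∃ (f : ℕ → StrongDual 𝕜 X) (y : ℕ → Y),
    IsNuclearRep T.toCLM f y ∧ ‖T‖ = ∑' n, ‖f n‖ * ‖y n‖

end NuclearOperator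

/-- The set of norm-attaining nuclear operators in `N(X, Y)`. -/
def normAttainingNuclear (𝕜 X Y : Type*) [RCLike 𝕜] [NormedAddCommGroup X] [NormedSpace 𝕜 X]
    [NormedAddCommGroup Y] [NormedSpace 𝕜 Y] : Set (NuclearOperator 𝕜 X Y) :=
  {T | T.AttainsNuclearNorm}

open Filter Topology

/-! ### Nuclear representations under contractions on either side. -/

section Representations

variable {𝕜 X Y : Type*} [RCLike 𝕜] [NormedAddCommGroup X] [NormedSpace 𝕜 X]
  [NormedAddCommGroup Y] [NormedSpace 𝕜 Y]

/-! Truncating a representation and approximating its vectors reduces density to operators `T` whose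
adjoint takes values in a finite dimensional 1-complemented `M ⊆ X*` and whose range lies in a
1-complemented `N ⊆ Y`. For such `T` pick a functional `φ` of norm at most 1 on the nuclear
operators with `φ T = ‖T‖`, and a representation `∑ fₙ ⊗ yₙ` that is optimal up to `δ`. The
projections push its terms into `M` and `N` at no extra cost. The defects `‖fₙ‖‖yₙ‖ - Re φ(fₙ ⊗ yₙ)`
are nonnegative and sum to less than `δ`. A term with small relative defect is moved slightly to one
where `φ` equals the product of the norms; a term with large relative defect is dropped, which its
defect pays for (`CompactAtMax.exists_replacement`). The new operator is close to `T`, and `φ`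
certifies that its new representation is optimal (`attainsNuclearNorm_of_re_apply`). Moving a term
needs almost maximizing pairs of unit vectors to be near maximizing pairs. This follows from
compactness of both unit spheres in (a), and in (b) from compactness in `M` together with uniform
convexity of `Y`. -/

theorem norm_smulRight_le (f : StrongDual 𝕜 X) (y : Y) :
    ‖f.smulRight y‖ ≤ ‖f‖ * ‖y‖ := by
  rw [ContinuousLinearMap.norm_smulRight_apply]

/-- A summable sequence of rank one operators defines a nuclear operator. -/
theorem exists_isNuclearRep [CompleteSpace Y] {f : ℕ → StrongDual 𝕜 X} {y : ℕ → Y}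
    (hf : ∃ C : ℝ, ∀ n, ‖f n‖ ≤ C) (hy : ∃ C : ℝ, ∀ n, ‖y n‖ ≤ C)
    (hs : Summable fun n => ‖f n‖ * ‖y n‖) :
    ∃ T : X →L[𝕜] Y, IsNuclearRep T f y := by
  have hsum : Summable fun n => (f n).smulRight (y n) :=
    Summable.of_norm_bounded hs fun n => norm_smulRight_le _ _
  refine ⟨∑' n, (f n).smulRight (y n), hf, hy, hs, fun x => ?_⟩
  exact hsum.hasSum.mapL (ContinuousLinearMap.apply 𝕜 Y x)

/-- Composing a nuclear representation with a contraction of `Y` that fixes the range. -/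
theorem IsNuclearRep.comp_right {T : X →L[𝕜] Y} {f : ℕ → StrongDual 𝕜 X} {y : ℕ → Y}
    (h : IsNuclearRep T f y) {Q : Y →L[𝕜] Y} (hQ : ‖Q‖ ≤ 1) (hQT : ∀ x, Q (T x) = T x) :
    IsNuclearRep T f (fun n => Q (y n)) := by
  have hle : ∀ z, ‖Q z‖ ≤ ‖z‖ := fun z => Q.le_of_opNorm_le_of_le hQ le_rfl |>.trans (one_mul _).le
  refine ⟨h.bounded_left, ?_, ?_, fun x => ?_⟩
  · obtain ⟨C, hC⟩ := h.bounded_right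
    exact ⟨C, fun n => (hle _).trans (hC n)⟩
  · exact h.summable.of_nonneg_of_le (fun n => by positivity)
      fun n => mul_le_mul_of_nonneg_left (hle _) (norm_nonneg _)
  · simpa [hQT] using (h.hasSum x).mapL Q

/-- Composing a nuclear representation with a contraction of the dual of `X` that fixes the range
of the adjoint. -/
theorem IsNuclearRep.comp_left [CompleteSpace Y] {T : X →L[𝕜] Y} {f : ℕ → StrongDual 𝕜 X}
    {y : ℕ → Y} (h : IsNuclearRep T f y) {P : StrongDual 𝕜 X →L[𝕜] StrongDual 𝕜 X}
    (hP : ‖P‖ ≤ 1) (hPT : ∀ φ : StrongDual 𝕜 Y, P (φ ∘L T) = φ ∘L T) :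
    IsNuclearRep T (fun n => P (f n)) y := by
  have hle : ∀ z, ‖P z‖ ≤ ‖z‖ := fun z => P.le_of_opNorm_le_of_le hP le_rfl |>.trans (one_mul _).le
  have hbd : ∃ C : ℝ, ∀ n, ‖P (f n)‖ ≤ C := by
    obtain ⟨C, hC⟩ := h.bounded_left
    exact ⟨C, fun n => (hle _).trans (hC n)⟩
  have hsum : Summable fun n => ‖P (f n)‖ * ‖y n‖ :=
    h.summable.of_nonneg_of_le (fun n => by positivity)
      fun n => mul_le_mul_of_nonneg_right (hle _) (norm_nonneg _)
  obtain ⟨S, hS⟩ := exists_isNuclearRep hbd h.bounded_right hsum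
  -- `P` acts on the dual and need not be an adjoint, so it cannot be moved onto `x`. Testing
  -- against `φ` turns the representation into the norm convergent series `∑ φ(yₙ) fₙ = φ ∘ T` in
  -- `X*`, where `P` applies termwise.
  suffices S = T from this ▸ hS
  ext x
  refine (SeparatingDual.eq_iff_forall_dual_eq (R := 𝕜)).2 fun φ => ?_
  have h1 : Summable fun n => φ (y n) • f n := by
    refine Summable.of_norm_bounded (h.summable.mul_left ‖φ‖) fun n => ?_
    rw [norm_smul, mul_comm ‖f n‖, ← mul_assoc]
    gcongr
    exact φ.le_opNorm _
  have h2 : HasSum (fun n => φ (y n) • f n) (φ ∘L T) := by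
    convert h1.hasSum using 1
    ext z
    have h3 := h1.hasSum.mapL (ContinuousLinearMap.apply 𝕜 𝕜 z)
    refine HasSum.unique ?_ h3
    simpa [mul_comm] using (h.hasSum z).mapL φ
  have h4 := (h2.mapL P).mapL (ContinuousLinearMap.apply 𝕜 𝕜 x)
  rw [hPT] at h4
  refine HasSum.unique ?_ h4
  simpa [mul_comm] using (hS.hasSum x).mapL φ

end Representations

namespace NuclearOperator

/-! ### Rank one operators and convergence in the nuclear norm. -/

section RankOne

variable {𝕜 X Y : Type*} [RCLike 𝕜] [NormedAddCommGroup X] [NormedSpace 𝕜 X]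
  [NormedAddCommGroup Y] [NormedSpace 𝕜 Y]

theorem isNuclearRep_smulRight (f : StrongDual 𝕜 X) (y : Y) :
    IsNuclearRep (f.smulRight y) (fun n => if n = 0 then f else 0)
      (fun n => if n = 0 then y else 0) where
  bounded_left := ⟨‖f‖, fun n => by split_ifs <;> simp⟩
  bounded_right := ⟨‖y‖, fun n => by split_ifs <;> simp⟩
  summable := summable_of_ne_finset_zero (s := {0}) fun n hn => by simp_all
  hasSum x := by
    convert hasSum_single (f := fun n : ℕ => (if n = 0 then f else 0) x • if n = 0 then y else 0)
      0 (fun n hn => by simp [hn]) using 1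
    simp

theorem norm_le_tsum {T : NuclearOperator 𝕜 X Y} {f : ℕ → StrongDual 𝕜 X} {y : ℕ → Y}
    (h : IsNuclearRep T.toCLM f y) : ‖T‖ ≤ ∑' n, ‖f n‖ * ‖y n‖ :=
  nuclearNorm_le h

/-- The rank one operator `f ⊗ y`, as a bounded bilinear map into the nuclear operators. -/
noncomputable def rankOne :
    StrongDual 𝕜 X →L[𝕜] Y →L[𝕜] NuclearOperator 𝕜 X Y :=
  LinearMap.mkContinuous₂
    (LinearMap.mk₂ 𝕜 (fun f y => (⟨f.smulRight y, _, _, isNuclearRep_smulRight f y⟩ :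
        NuclearOperator 𝕜 X Y))
      (fun f g y => Subtype.ext (by ext x; exact add_smul _ _ _))
      (fun c f y => Subtype.ext (by ext x; exact mul_smul _ _ _))
      (fun f y z => Subtype.ext (by ext x; exact smul_add _ _ _))
      (fun c f y => Subtype.ext (by ext x; exact smul_comm _ _ _)))
    1 (fun f y => by
      refine (nuclearNorm_le (isNuclearRep_smulRight f y)).trans ?_
      rw [tsum_eq_single 0 fun n hn => by simp [hn]]
      simp)

theorem continuous_rankOne :
    Continuous fun p : StrongDual 𝕜 X × Y => (rankOne p.1 p.2 : NuclearOperator 𝕜 X Y) :=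
  (rankOne (𝕜 := 𝕜) (X := X) (Y := Y)).continuous₂

/-- Transfers approximation of finitely many vectors in `X*` and `Y` to approximation of finite rank
operators in the nuclear norm. -/
theorem continuous_sum_rankOne {ι : Type*} [Fintype ι] :
    Continuous fun p : (ι → StrongDual 𝕜 X) × (ι → Y) =>
      (∑ i, rankOne (p.1 i) (p.2 i) : NuclearOperator 𝕜 X Y) :=
  continuous_finsetSum _ fun i _ => by
    have h : Continuous fun p : (ι → StrongDual 𝕜 X) × (ι → Y) => (p.1 i, p.2 i) :=
      ((continuous_apply i).comp continuous_fst).prodMk ((continuous_apply i).comp continuous_snd)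
    have h' := (continuous_rankOne (𝕜 := 𝕜) (X := X) (Y := Y)).comp h
    exact h'

theorem toCLM_rankOne (f : StrongDual 𝕜 X) (y : Y) : (rankOne f y).toCLM = f.smulRight y := rfl

theorem toCLM_add (S T : NuclearOperator 𝕜 X Y) : (S + T).toCLM = S.toCLM + T.toCLM := rfl

theorem norm_rankOne_le (f : StrongDual 𝕜 X) (y : Y) :
    ‖(rankOne f y : NuclearOperator 𝕜 X Y)‖ ≤ ‖f‖ * ‖y‖ := by
  refine (norm_le_tsum (T := rankOne f y) (isNuclearRep_smulRight f y)).trans ?_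
  rw [tsum_eq_single 0 fun n hn => by simp [hn]]
  simp

theorem toCLM_sum {ι : Type*} (s : Finset ι) (T : ι → NuclearOperator 𝕜 X Y) :
    (∑ i ∈ s, T i).toCLM = ∑ i ∈ s, (T i).toCLM := by
  classical
  induction s using Finset.induction_on with
  | empty => rfl
  | insert a s ha ih => rw [Finset.sum_insert ha, Finset.sum_insert ha, toCLM_add, ih]

/-- A nuclear representation converges in the nuclear norm. -/
theorem hasSum_rankOne {T : NuclearOperator 𝕜 X Y} {f : ℕ → StrongDual 𝕜 X} {y : ℕ → Y}
    (h : IsNuclearRep T.toCLM f y) : HasSum (fun n => rankOne (f n) (y n)) T := by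
  classical
  -- Annihilating the terms indexed by `s` gives a representation of the remainder, whose cost is
  -- the tail of the scalar series.
  have key : ∀ s : Finset ℕ, ‖T - ∑ n ∈ s, rankOne (f n) (y n)‖ ≤
      ∑' n, ‖f n‖ * ‖y n‖ - ∑ n ∈ s, ‖f n‖ * ‖y n‖ := by
    intro s
    have hs : HasSum (fun n => ‖if n ∈ s then 0 else f n‖ * ‖y n‖)
        (∑' n, ‖f n‖ * ‖y n‖ - ∑ n ∈ s, ‖f n‖ * ‖y n‖) := by
      have := h.summable.hasSum.sub (hasSum_sum_of_ne_finset_zero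
        (f := fun n => if n ∈ s then ‖f n‖ * ‖y n‖ else 0) (s := s)
        (fun n hn => by simp [hn]))
      rw [Finset.sum_congr rfl (fun n hn => if_pos hn)] at this
      refine (congrArg (HasSum · _) (funext fun n => ?_)).mp this
      split_ifs <;> simp
    have hrep : IsNuclearRep (T - ∑ n ∈ s, rankOne (f n) (y n)).toCLM
        (fun n => if n ∈ s then 0 else f n) y := by
      refine ⟨?_, h.bounded_right, hs.summable, fun x => ?_⟩
      · obtain ⟨C, hC⟩ := h.bounded_left
        refine ⟨C, fun n => ?_⟩
        split_ifs
        · simpa using (norm_nonneg _).trans (hC n)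
        · exact hC n
      · have := (h.hasSum x).sub (hasSum_sum_of_ne_finset_zero
          (f := fun n => if n ∈ s then f n x • y n else 0) (s := s)
          (fun n hn => by simp [hn]))
        rw [Finset.sum_congr rfl (fun n hn => if_pos hn)] at this
        convert this using 1
        · funext n
          split_ifs <;> simp
        · change T.toCLM x - (∑ n ∈ s, rankOne (f n) (y n)).toCLM x = _
          simp [toCLM_sum, toCLM_rankOne]
    exact (norm_le_tsum hrep).trans hs.tsum_eq.le
  rw [HasSum, SummationFilter.unconditional_filter, tendsto_iff_norm_sub_tendsto_zero]
  refine squeeze_zero (fun _ => norm_nonneg _) (fun s => (norm_sub_rev _ _).trans_le (key s)) ?_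
  have := (h.summable.hasSum).const_sub (∑' n, ‖f n‖ * ‖y n‖)
  simpa using this

theorem exists_rep_lt (T : NuclearOperator 𝕜 X Y) {δ : ℝ} (hδ : 0 < δ) :
    ∃ (f : ℕ → StrongDual 𝕜 X) (y : ℕ → Y), IsNuclearRep T.toCLM f y ∧
      ∑' n, ‖f n‖ * ‖y n‖ < ‖T‖ + δ := by
  obtain ⟨f, y, h⟩ := T.2
  obtain ⟨_, ⟨g, z, hg, rfl⟩, hlt⟩ := exists_lt_of_csInf_lt
    (s := nuclearRepValues T.toCLM) ⟨_, f, y, h, rfl⟩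
    (show sInf (nuclearRepValues T.toCLM) < ‖T‖ + δ from lt_add_of_pos_right _ hδ)
  exact ⟨g, z, hg, hlt⟩

end RankOne

/-! ### Replacing terms by maximizers of a norming functional. -/

section Density

variable {𝕜 X Y : Type*} [RCLike 𝕜] [NormedAddCommGroup X] [NormedSpace 𝕜 X]
  [NormedAddCommGroup Y] [NormedSpace 𝕜 Y]

theorem re_apply_rankOne_le {φ : StrongDual 𝕜 (NuclearOperator 𝕜 X Y)} (hφ : ‖φ‖ ≤ 1)
    (f : StrongDual 𝕜 X) (y : Y) : RCLike.re (φ (rankOne f y)) ≤ ‖f‖ * ‖y‖ :=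
  (RCLike.re_le_norm _).trans <|
    (φ.le_of_opNorm_le_of_le hφ (norm_rankOne_le f y)).trans (one_mul _).le

/-- The bilinear form `(u, v) ↦ φ (u ⊗ v)` is compact at its maximum on `M × N`: maximizing
sequences of unit vectors have convergent subsequences. -/
def CompactAtMax (φ : StrongDual 𝕜 (NuclearOperator 𝕜 X Y)) (M : Submodule 𝕜 (StrongDual 𝕜 X))
    (N : Submodule 𝕜 Y) : Prop :=
  ∀ (u : ℕ → StrongDual 𝕜 X) (v : ℕ → Y), (∀ n, u n ∈ M) → (∀ n, v n ∈ N) →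
    (∀ n, ‖u n‖ = 1) → (∀ n, ‖v n‖ = 1) →
    Tendsto (fun n => RCLike.re (φ (rankOne (u n) (v n)))) atTop (𝓝 1) →
    ∃ (a : StrongDual 𝕜 X) (b : Y) (θ : ℕ → ℕ), StrictMono θ ∧
      Tendsto (u ∘ θ) atTop (𝓝 a) ∧ Tendsto (v ∘ θ) atTop (𝓝 b)

theorem tendsto_re_rankOne (φ : StrongDual 𝕜 (NuclearOperator 𝕜 X Y)) {u : ℕ → StrongDual 𝕜 X}
    {v : ℕ → Y} {a : StrongDual 𝕜 X} {b : Y} (hu : Tendsto u atTop (𝓝 a))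
    (hv : Tendsto v atTop (𝓝 b)) :
    Tendsto (fun n => RCLike.re (φ (rankOne (u n) (v n)))) atTop
      (𝓝 (RCLike.re (φ (rankOne a b)))) := by
  have h := ((continuous_rankOne (𝕜 := 𝕜) (X := X) (Y := Y)).tendsto (a, b)).comp
    (hu.prodMk_nhds hv)
  have h' := ((RCLike.continuous_re (K := 𝕜)).tendsto _).comp ((φ.continuous.tendsto _).comp h)
  exact h'

/-- Near maximizers of a form that is compact at its maximum are close to maximizers. -/
theorem CompactAtMax.exists_near {φ : StrongDual 𝕜 (NuclearOperator 𝕜 X Y)}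
    {M : Submodule 𝕜 (StrongDual 𝕜 X)} {N : Submodule 𝕜 Y}
    (hc : CompactAtMax φ M N) (hφ : ‖φ‖ ≤ 1) {ε : ℝ} (hε : 0 < ε) :
    ∃ η : ℝ, 0 < η ∧ ∀ u ∈ M, ∀ v ∈ N, ‖u‖ = 1 → ‖v‖ = 1 →
      1 - η < RCLike.re (φ (rankOne u v)) →
      ∃ (a : StrongDual 𝕜 X) (b : Y), ‖a‖ = 1 ∧ ‖b‖ = 1 ∧
        RCLike.re (φ (rankOne a b)) = 1 ∧ ‖u - a‖ < ε ∧ ‖v - b‖ < ε := by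
  -- Counterexamples for `η = 1/(n+1)` form a maximizing sequence; a subsequential limit is a
  -- maximizing pair of unit vectors, eventually closer than `ε`.
  by_contra! hcon
  have hpos : ∀ n : ℕ, (0 : ℝ) < 1 / ((n : ℝ) + 1) := fun n => by positivity
  choose u hu v hv hu1 hv1 hre hfar using fun n : ℕ => hcon _ (hpos n)
  have hlim : Tendsto (fun n => RCLike.re (φ (rankOne (u n) (v n)))) atTop (𝓝 1) := by
    refine tendsto_of_tendsto_of_tendsto_of_le_of_le
      (g := fun n : ℕ => 1 - 1 / ((n : ℝ) + 1)) (h := fun _ => 1) ?_ tendsto_const_nhds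
      (fun n => (hre n).le) (fun n => ?_)
    · simpa using (tendsto_one_div_add_atTop_nhds_zero_nat (𝕜 := ℝ)).const_sub 1
    · simpa [hu1, hv1] using re_apply_rankOne_le hφ (u n) (v n)
  obtain ⟨a, b, θ, hθ, ha, hb⟩ := hc u v hu hv hu1 hv1 hlim
  have ha1 : ‖a‖ = 1 := tendsto_nhds_unique ha.norm (by simp [hu1])
  have hb1 : ‖b‖ = 1 := tendsto_nhds_unique hb.norm (by simp [hv1])
  have hab : RCLike.re (φ (rankOne a b)) = 1 :=
    tendsto_nhds_unique (tendsto_re_rankOne φ ha hb) (hlim.comp hθ.tendsto_atTop)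
  obtain ⟨n, h1, h2⟩ := ((ha.eventually (Metric.ball_mem_nhds a hε)).and
    (hb.eventually (Metric.ball_mem_nhds b hε))).exists
  simp only [Function.comp, ← dist_eq_norm] at h1 h2 hfar
  exact absurd h2 (not_lt.2 (hfar (θ n) a b ha1 hb1 hab h1))

/-- A rank one operator is replaced by one at which `φ` attains its maximum, at a cost controlled
by how far `φ` is from its maximum. -/
theorem CompactAtMax.exists_replacement {φ : StrongDual 𝕜 (NuclearOperator 𝕜 X Y)}
    {M : Submodule 𝕜 (StrongDual 𝕜 X)} {N : Submodule 𝕜 Y}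
    (hc : CompactAtMax φ M N) (hφ : ‖φ‖ ≤ 1) {ε : ℝ} (hε : 0 < ε) :
    ∃ K : ℝ, 0 < K ∧ ∀ f ∈ M, ∀ y ∈ N, ∃ (g : StrongDual 𝕜 X) (z : Y),
      ‖g‖ ≤ ‖f‖ * ‖y‖ ∧ ‖z‖ ≤ 1 ∧ RCLike.re (φ (rankOne g z)) = ‖g‖ * ‖z‖ ∧
      ‖rankOne f y - rankOne g z‖ ≤
        ε * (‖f‖ * ‖y‖) + K * (‖f‖ * ‖y‖ - RCLike.re (φ (rankOne f y))) := by
  obtain ⟨η, hη, h⟩ := hc.exists_near hφ (half_pos hε)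
  refine ⟨1 / η, by positivity, fun f hf y hy => ?_⟩
  have hle := re_apply_rankOne_le hφ f y
  by_cases hbad : RCLike.re (φ (rankOne f y)) ≤ (1 - η) * (‖f‖ * ‖y‖)
  -- Large relative defect: the term is dropped, since its size is at most its defect divided by
  -- `η`.
  · refine ⟨0, 0, by simp; positivity, by simp, by simp, ?_⟩
    have h1 : ‖f‖ * ‖y‖ ≤ 1 / η * (‖f‖ * ‖y‖ - RCLike.re (φ (rankOne f y))) := by
      rw [one_div, ← div_eq_inv_mul, le_div_iff₀ hη]
      linarith
    have h2 : 0 ≤ ε * (‖f‖ * ‖y‖) := by positivity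
    have h3 := norm_rankOne_le (𝕜 := 𝕜) f y
    simp only [map_zero, sub_zero]
    linarith
  · push Not at hbad
    have hf0 : f ≠ 0 := by rintro rfl; simp at hbad
    have hy0 : y ≠ 0 := by rintro rfl; simp at hbad
    have hf' : 0 < ‖f‖ := norm_pos_iff.2 hf0
    have hy' : 0 < ‖y‖ := norm_pos_iff.2 hy0
    set r : ℝ := ‖f‖ * ‖y‖ with hr
    have hr0 : 0 < r := by positivity
    set u := ((‖f‖⁻¹ : ℝ) : 𝕜) • f with hu
    set v := ((‖y‖⁻¹ : ℝ) : 𝕜) • y with hv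
    have hu1 : ‖u‖ = 1 := by
      rw [hu, norm_smul, RCLike.norm_ofReal, abs_of_pos (by positivity), inv_mul_cancel₀ hf'.ne']
    have hv1 : ‖v‖ = 1 := by
      rw [hv, norm_smul, RCLike.norm_ofReal, abs_of_pos (by positivity), inv_mul_cancel₀ hy'.ne']
    have hfy : rankOne f y = (r : 𝕜) • rankOne u v := by
      rw [hu, hv, map_smul, map_smul, smul_apply, smul_smul, smul_smul,
        ← RCLike.ofReal_mul, ← RCLike.ofReal_mul]
      rw [show r * ‖y‖⁻¹ * ‖f‖⁻¹ = 1 by rw [hr]; field_simp]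
      simp
    have hre : RCLike.re (φ (rankOne f y)) = r * RCLike.re (φ (rankOne u v)) := by
      rw [hfy, map_smul, smul_eq_mul, RCLike.re_ofReal_mul]
    have huv : 1 - η < RCLike.re (φ (rankOne u v)) := by
      rw [hre, mul_comm] at hbad
      exact lt_of_mul_lt_mul_left hbad hr0.le
    obtain ⟨a, b, ha, hb, hab, hua, hvb⟩ :=
      h u (M.smul_mem _ hf) v (N.smul_mem _ hy) hu1 hv1 huv
    have hra : ‖(r : 𝕜) • a‖ = r := by
      rw [norm_smul, ha, mul_one, RCLike.norm_ofReal, abs_of_pos hr0]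
    -- The whole weight `r` goes on the left factor, so that the right factors stay bounded by 1 and
    -- the left ones are summable.
    refine ⟨(r : 𝕜) • a, b, hra.le, hb.le, ?_, ?_⟩
    · rw [map_smul, smul_apply, map_smul, smul_eq_mul, RCLike.re_ofReal_mul,
        hab, hra, hb]
    · have hdiff : rankOne f y - rankOne ((r : 𝕜) • a) b =
          (r : 𝕜) • (rankOne (u - a) v + rankOne a (v - b)) := by
        rw [hfy, map_smul rankOne (r : 𝕜) a, smul_apply, ← smul_sub]
        simp only [map_sub, sub_apply]
        congr 1
        abel
      have h1 : ‖(rankOne (u - a) v : NuclearOperator 𝕜 X Y)‖ ≤ ε / 2 := by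
        have := norm_rankOne_le (𝕜 := 𝕜) (u - a) v
        rw [hv1] at this
        linarith
      have h2 : ‖(rankOne a (v - b) : NuclearOperator 𝕜 X Y)‖ ≤ ε / 2 := by
        have := norm_rankOne_le (𝕜 := 𝕜) a (v - b)
        rw [ha] at this
        linarith
      have h3 : 0 ≤ 1 / η * (r - RCLike.re (φ (rankOne f y))) :=
        mul_nonneg (by positivity) (sub_nonneg.2 hle)
      have h4 : ‖(rankOne (u - a) v + rankOne a (v - b) : NuclearOperator 𝕜 X Y)‖ ≤ ε :=
        (norm_add_le _ _).trans (by linarith)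
      rw [hdiff, norm_smul, RCLike.norm_ofReal, abs_of_pos hr0]
      nlinarith [mul_le_mul_of_nonneg_left h4 hr0.le]

/-- If `φ` takes the value of a nuclear representation of `T`, that representation is optimal. -/
theorem attainsNuclearNorm_of_re_apply {T : NuclearOperator 𝕜 X Y} {f : ℕ → StrongDual 𝕜 X}
    {y : ℕ → Y} (h : IsNuclearRep T.toCLM f y) {φ : StrongDual 𝕜 (NuclearOperator 𝕜 X Y)}
    (hφ : ‖φ‖ ≤ 1) (heq : ∀ n, RCLike.re (φ (rankOne (f n) (y n))) = ‖f n‖ * ‖y n‖) :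
    T.AttainsNuclearNorm := by
  refine ⟨f, y, h, (norm_le_tsum h).antisymm ?_⟩
  have h1 := ((hasSum_rankOne h).mapL φ).mapL (RCLike.reCLM (K := 𝕜))
  simp only [RCLike.reCLM_apply, heq] at h1
  rw [h1.tsum_eq]
  exact (RCLike.re_le_norm _).trans <|
    (φ.le_of_opNorm_le_of_le hφ le_rfl).trans (one_mul _).le

/-- A nuclear operator supported on `1`-complemented subspaces is a limit of norm attaining ones if
all bilinear forms on these subspaces are compact at their maximum. -/
theorem mem_closure_normAttainingNuclear [CompleteSpace Y] {M : Submodule 𝕜 (StrongDual 𝕜 X)}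
    {N : Submodule 𝕜 Y} (hM : IsOneComplemented M) (hN : IsOneComplemented N)
    (hc : ∀ φ : StrongDual 𝕜 (NuclearOperator 𝕜 X Y), ‖φ‖ ≤ 1 → CompactAtMax φ M N)
    (T : NuclearOperator 𝕜 X Y) (hTM : ∀ ψ : StrongDual 𝕜 Y, ψ ∘L T.toCLM ∈ M)
    (hTN : ∀ x, T.toCLM x ∈ N) : T ∈ closure (normAttainingNuclear 𝕜 X Y) := by
  obtain ⟨P, hP, hPM, hPid⟩ := hM
  obtain ⟨Q, hQ, hQN, hQid⟩ := hN
  obtain ⟨φ, hφ, hφT⟩ := exists_dual_vector'' 𝕜 T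
  refine Metric.mem_closure_iff.2 fun ε hε => ?_
  -- The proportional errors total at most `ε₁(‖T‖ + 1) = ε/2` and the defects cost at most `Kδ ≤
  -- ε/4`. `K` depends only on `φ` and `ε₁`, so `δ` and the representation can be chosen after it.
  set ε₁ : ℝ := ε / (2 * (‖T‖ + 1)) with hε₁
  have hT1 : 0 < ‖T‖ + 1 := by positivity
  have hε₁' : 0 < ε₁ := by positivity
  obtain ⟨K, hK, hrepl⟩ := (hc φ hφ).exists_replacement hφ hε₁'
  set δ : ℝ := min 1 (ε / (4 * K)) with hδ
  have hδ' : 0 < δ := by positivity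
  obtain ⟨f₀, y₀, hrep₀, hlt₀⟩ := T.exists_rep_lt hδ'
  have hrep : IsNuclearRep T.toCLM (fun n => P (f₀ n)) (fun n => Q (y₀ n)) :=
    (hrep₀.comp_left hP fun ψ => hPid _ (hTM ψ)).comp_right hQ fun x => hQid _ (hTN x)
  have hlt : ∑' n, ‖P (f₀ n)‖ * ‖Q (y₀ n)‖ < ‖T‖ + δ := by
    refine lt_of_le_of_lt (hrep.summable.tsum_le_tsum (fun n => ?_) hrep₀.summable) hlt₀
    have h1 := P.le_of_opNorm_le hP (f₀ n)
    have h2 := Q.le_of_opNorm_le hQ (y₀ n)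
    rw [one_mul] at h1 h2
    gcongr
  choose g z hg hz hgz hdist using fun n => hrepl _ (hPM (f₀ n)) _ (hQN (y₀ n))
  set f := fun n => P (f₀ n)
  set y := fun n => Q (y₀ n)
  have hs := hrep.summable
  have hsg : Summable fun n => ‖g n‖ * ‖z n‖ :=
    hs.of_nonneg_of_le (fun n => by positivity) fun n =>
      (mul_le_of_le_one_right (norm_nonneg _) (hz n)).trans (hg n)
  obtain ⟨S, hS⟩ := exists_isNuclearRep (f := g) (y := z)
    ⟨∑' n, ‖f n‖ * ‖y n‖, fun n => (hg n).trans (hs.le_tsum n fun m _ => by positivity)⟩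
    ⟨1, hz⟩ hsg
  let S' : NuclearOperator 𝕜 X Y := ⟨S, g, z, hS⟩
  have hS' : IsNuclearRep S'.toCLM g z := hS
  refine ⟨S', attainsNuclearNorm_of_re_apply hS' hφ hgz, ?_⟩
  have hre : HasSum (fun n => RCLike.re (φ (rankOne (f n) (y n)))) ‖T‖ := by
    have := ((hasSum_rankOne hrep).mapL φ).mapL (RCLike.reCLM (K := 𝕜))
    simpa [hφT] using this
  have hbound := (hs.hasSum.mul_left ε₁).add ((hs.hasSum.sub hre).mul_left K)
  have hle := ((hasSum_rankOne hrep).sub (hasSum_rankOne hS')).norm_le_of_bounded hbound hdist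
  rw [dist_eq_norm]
  refine hle.trans_lt ?_
  have h1 : ∑' n, ‖f n‖ * ‖y n‖ < ‖T‖ + 1 := hlt.trans_le (by gcongr; exact min_le_left _ _)
  have h2 : K * (∑' n, ‖f n‖ * ‖y n‖ - ‖T‖) ≤ ε / 4 := by
    have : ∑' n, ‖f n‖ * ‖y n‖ - ‖T‖ ≤ ε / (4 * K) := by
      linarith [min_le_right 1 (ε / (4 * K))]
    calc _ ≤ K * (ε / (4 * K)) := by gcongr
      _ = ε / 4 := by field_simp
  have h3 : ε₁ * (∑' n, ‖f n‖ * ‖y n‖) ≤ ε / 2 := by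
    calc _ ≤ ε₁ * (‖T‖ + 1) := by gcongr
      _ = ε / 2 := by rw [hε₁]; field_simp
  linarith

/-! ### Reduction to operators supported on 1-complemented subspaces. -/

theorem _root_.MetricPiProperty.exists_submodule {E : Type*} [NormedAddCommGroup E]
    [NormedSpace 𝕜 E] (h : MetricPiProperty 𝕜 E) {n : ℕ} (x : Fin n → E) {ε : ℝ} (hε : 0 < ε) :
    ∃ M : Submodule 𝕜 E, FiniteDimensional 𝕜 M ∧ IsOneComplemented M ∧
      ∃ x' : Fin n → E, (∀ i, x' i ∈ M) ∧ ∀ i, ‖x i - x' i‖ < ε := by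
  classical
  -- The π-property speaks only of unit vectors: nonzero `x i` are normalized, approximated within
  -- `ε / R` and scaled back. The `+ 1` keeps `R` positive.
  set R : ℝ := ∑ i, ‖x i‖ + 1 with hR
  have hR0 : 0 < R := by positivity
  let w : Fin n → E := fun i => ((‖x i‖⁻¹ : ℝ) : 𝕜) • x i
  have hw : ∀ i, x i ≠ 0 → ‖w i‖ = 1 := fun i hi => by
    have : 0 < ‖x i‖ := norm_pos_iff.2 hi
    simp only [w]
    rw [norm_smul, RCLike.norm_ofReal, abs_of_pos (by positivity), inv_mul_cancel₀ this.ne']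
  obtain ⟨M, hfd, hM, hap⟩ := h (ε / R) (by positivity)
    ((Finset.univ.filter fun i => x i ≠ 0).image w) (by
      intro a ha
      simp only [Finset.mem_image, Finset.mem_filter, Finset.mem_univ, true_and] at ha
      obtain ⟨i, hi, rfl⟩ := ha
      exact hw i hi)
  refine ⟨M, hfd, hM, ?_⟩
  have hpt : ∀ i, ∃ x' ∈ M, ‖x i - x'‖ < ε := by
    intro i
    by_cases hi : x i = 0
    · exact ⟨0, M.zero_mem, by simpa [hi] using hε⟩
    have hpos : 0 < ‖x i‖ := norm_pos_iff.2 hi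
    obtain ⟨a, ha, hlt⟩ := hap (w i) (Finset.mem_image_of_mem _ (by simpa using hi))
    refine ⟨((‖x i‖ : ℝ) : 𝕜) • a, M.smul_mem _ ha, ?_⟩
    have hxi : x i = ((‖x i‖ : ℝ) : 𝕜) • w i := by
      simp only [w]
      rw [smul_smul, ← RCLike.ofReal_mul, mul_inv_cancel₀ hpos.ne']
      simp
    have hle : ‖x i‖ ≤ R := by
      have := Finset.single_le_sum (f := fun i => ‖x i‖) (fun i _ => norm_nonneg _)
        (Finset.mem_univ i)
      linarith
    have heq : x i - ((‖x i‖ : ℝ) : 𝕜) • a = ((‖x i‖ : ℝ) : 𝕜) • (w i - a) := by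
      rw [smul_sub, ← hxi]
    rw [heq, norm_smul, RCLike.norm_ofReal, abs_of_pos hpos]
    calc ‖x i‖ * ‖w i - a‖ < ‖x i‖ * (ε / R) := by gcongr
      _ ≤ R * (ε / R) := by gcongr
      _ = ε := by field_simp
  choose x' hx' hlt using hpt
  exact ⟨x', hx', hlt⟩

/-- Density of the norm attaining nuclear operators, from approximation of finite families of `Y`
by `1`-complemented subspaces on which all bilinear forms are compact at their maximum. -/
theorem closure_normAttainingNuclear_eq_univ [CompleteSpace Y]
    (hX : MetricPiProperty 𝕜 (StrongDual 𝕜 X))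
    (hY : ∀ (n : ℕ) (y : Fin n → Y) (ε : ℝ), 0 < ε → ∃ N : Submodule 𝕜 Y, IsOneComplemented N ∧
      (∃ y' : Fin n → Y, (∀ i, y' i ∈ N) ∧ ∀ i, ‖y i - y' i‖ < ε) ∧
      ∀ M : Submodule 𝕜 (StrongDual 𝕜 X), FiniteDimensional 𝕜 M →
        ∀ φ : StrongDual 𝕜 (NuclearOperator 𝕜 X Y), ‖φ‖ ≤ 1 → CompactAtMax φ M N) :
    closure (normAttainingNuclear 𝕜 X Y) = Set.univ := by
  refine Set.eq_univ_of_forall fun T => ?_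
  -- The finite rank approximants are themselves only limits of norm attaining operators.
  rw [← closure_closure]
  refine Metric.mem_closure_iff.2 fun ε hε => ?_
  obtain ⟨f, y, hrep⟩ := T.2
  obtain ⟨n, hn⟩ := ((Metric.tendsto_atTop.1
    (hasSum_rankOne (T := T) hrep).tendsto_sum_nat) (ε / 2) (half_pos hε)).imp fun n h => h n le_rfl
  rw [← Fin.sum_univ_eq_sum_range (fun i => rankOne (f i) (y i))] at hn
  obtain ⟨δ, hδ, hclose⟩ := Metric.continuous_iff.1
    (continuous_sum_rankOne (𝕜 := 𝕜) (X := X) (Y := Y) (ι := Fin n)) (fun i => f i, fun i => y i)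
    (ε / 2) (half_pos hε)
  obtain ⟨M, hfd, hM, g, hg, hgf⟩ := hX.exists_submodule (fun i : Fin n => f i) hδ
  obtain ⟨N, hN, ⟨z, hz, hzy⟩, hcomp⟩ := hY n (fun i => y i) δ hδ
  have hST := hclose (g, z) (by
    rw [Prod.dist_eq, max_lt_iff, dist_pi_lt_iff hδ, dist_pi_lt_iff hδ]
    exact ⟨fun i => by rw [dist_comm, dist_eq_norm]; exact hgf i,
      fun i => by rw [dist_comm, dist_eq_norm]; exact hzy i⟩)
  refine ⟨∑ i, rankOne (g i) (z i), mem_closure_normAttainingNuclear hM hN (hcomp M hfd) _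
    (fun ψ => ?_) (fun x => ?_), ?_⟩
  · have : ψ ∘L (∑ i, rankOne (g i) (z i) : NuclearOperator 𝕜 X Y).toCLM =
        ∑ i, ψ (z i) • g i := by
      ext x
      simp [toCLM_sum, toCLM_rankOne, mul_comm]
    rw [this]
    exact M.sum_mem fun i _ => M.smul_mem _ (hg i)
  · have : (∑ i, rankOne (g i) (z i) : NuclearOperator 𝕜 X Y).toCLM x = ∑ i, g i x • z i := by
      simp [toCLM_sum, toCLM_rankOne]
    rw [this]
    exact N.sum_mem fun i _ => N.smul_mem _ (hz i)
  · rw [dist_comm] at hn hST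
    linarith [dist_triangle T (∑ i : Fin n, rankOne (f i) (y i)) (∑ i, rankOne (g i) (z i))]

/-! ### Compactness of maximizing sequences. -/

theorem exists_subseq_tendsto_of_mem {E : Type*} [NormedAddCommGroup E] [NormedSpace 𝕜 E]
    (M : Submodule 𝕜 E) [FiniteDimensional 𝕜 M] {u : ℕ → E} (hu : ∀ n, u n ∈ M)
    (hu1 : ∀ n, ‖u n‖ = 1) :
    ∃ (a : E) (θ : ℕ → ℕ), StrictMono θ ∧ Tendsto (u ∘ θ) atTop (𝓝 a) := by
  have : ProperSpace M := FiniteDimensional.proper 𝕜 M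
  obtain ⟨a, -, θ, hθ, ha⟩ := tendsto_subseq_of_bounded (Metric.isBounded_closedBall (x := (0 : M))
    (r := 1)) (x := fun n => ⟨u n, hu n⟩) (fun n => by simp [hu1])
  exact ⟨a, θ, hθ, (continuous_subtype_val.tendsto a).comp ha⟩

theorem compactAtMax_of_finiteDimensional (φ : StrongDual 𝕜 (NuclearOperator 𝕜 X Y))
    (M : Submodule 𝕜 (StrongDual 𝕜 X)) (N : Submodule 𝕜 Y) [FiniteDimensional 𝕜 M]
    [FiniteDimensional 𝕜 N] : CompactAtMax φ M N := by
  intro u v hu hv hu1 hv1 _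
  obtain ⟨a, θ, hθ, ha⟩ := exists_subseq_tendsto_of_mem M hu hu1
  obtain ⟨b, κ, hκ, hb⟩ := exists_subseq_tendsto_of_mem N (u := v ∘ θ) (fun n => hv _)
    (fun n => hv1 _)
  exact ⟨a, b, θ ∘ κ, hθ.comp hκ, ha.comp hκ.tendsto_atTop, hb⟩

/-- In a uniformly convex space, unit vectors that maximize a norm one functional converge. -/
theorem cauchySeq_of_tendsto_re_one [UniformConvexSpace Y] {ψ : StrongDual 𝕜 Y} (hψ : ‖ψ‖ ≤ 1)
    {v : ℕ → Y} (hv : ∀ n, ‖v n‖ = 1)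
    (hlim : Tendsto (fun n => RCLike.re (ψ (v n))) atTop (𝓝 1)) : CauchySeq v := by
  refine Metric.cauchySeq_iff.2 fun ε hε => ?_
  obtain ⟨δ, hδ, hconv⟩ := exists_forall_sphere_dist_add_le_two_sub Y hε
  obtain ⟨n, hn⟩ := eventually_atTop.1
    (hlim.eventually (lt_mem_nhds (show 1 - δ / 2 < 1 by linarith)))
  refine ⟨n, fun i hi j hj => ?_⟩
  -- Points at distance at least `ε` would give `‖v i + v j‖ ≤ 2 - δ`, while `Re ψ` exceeds `1 -
  -- δ/2` at each of them.
  by_contra! hcon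
  rw [dist_eq_norm] at hcon
  have h1 := hconv (hv i) (hv j) hcon
  have h2 : RCLike.re (ψ (v i + v j)) ≤ ‖v i + v j‖ :=
    (RCLike.re_le_norm _).trans ((ψ.le_of_opNorm_le hψ _).trans (one_mul _).le)
  rw [map_add, map_add] at h2
  linarith [hn i hi, hn j hj]

/-- After passing to a subsequence `uₙ → a`, the fixed functional `φ(a ⊗ ·)` of norm at most 1 is
maximized along the `vₙ`, so uniform convexity makes them converge. -/
theorem compactAtMax_of_uniformConvexSpace [UniformConvexSpace Y] [CompleteSpace Y]
    {φ : StrongDual 𝕜 (NuclearOperator 𝕜 X Y)} (hφ : ‖φ‖ ≤ 1)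
    (M : Submodule 𝕜 (StrongDual 𝕜 X)) (N : Submodule 𝕜 Y) [FiniteDimensional 𝕜 M] :
    CompactAtMax φ M N := by
  intro u v hu hv hu1 hv1 hlim
  obtain ⟨a, θ, hθ, ha⟩ := exists_subseq_tendsto_of_mem M hu hu1
  have ha1 : ‖a‖ = 1 := tendsto_nhds_unique ha.norm (by simp [hu1])
  have hψ : ‖φ ∘L rankOne a‖ ≤ 1 := by
    refine ContinuousLinearMap.opNorm_le_bound _ zero_le_one fun y => ?_
    refine φ.le_of_opNorm_le_of_le hφ ((norm_rankOne_le a y).trans ?_)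
    rw [ha1, one_mul]
  have hdiff : Tendsto (fun n => RCLike.re (φ (rankOne (u (θ n) - a) (v (θ n))))) atTop
      (𝓝 0) := by
    refine squeeze_zero_norm (a := fun n => ‖u (θ n) - a‖) (fun n => ?_)
      (tendsto_iff_norm_sub_tendsto_zero.1 ha)
    refine (RCLike.norm_re_le_norm _).trans
      ((φ.le_of_opNorm_le_of_le hφ (norm_rankOne_le _ _)).trans ?_)
    rw [hv1, one_mul, mul_one]
  have hlim' : Tendsto (fun n => RCLike.re ((φ ∘L rankOne a) ((v ∘ θ) n))) atTop (𝓝 1) := by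
    have := (hlim.comp hθ.tendsto_atTop).sub hdiff
    simpa using this
  obtain ⟨b, hb⟩ := cauchySeq_tendsto_of_complete
    (cauchySeq_of_tendsto_re_one hψ (v := v ∘ θ) (fun n => hv1 _) hlim')
  exact ⟨a, b, θ, hθ, ha, hb⟩

end Density

end NuclearOperator

theorem mainTheorem12 {𝕜 X Y : Type*} [RCLike 𝕜]
    [NormedAddCommGroup X] [NormedSpace 𝕜 X] [CompleteSpace X]
    [NormedAddCommGroup Y] [NormedSpace 𝕜 Y] [CompleteSpace Y]
    (hX : MetricPiProperty 𝕜 (StrongDual 𝕜 X)) :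
    (MetricPiProperty 𝕜 Y → closure (normAttainingNuclear 𝕜 X Y) = Set.univ) ∧
      (UniformConvexSpace Y → closure (normAttainingNuclear 𝕜 X Y) = Set.univ) := by
  refine ⟨fun hY => ?_, fun hY => ?_⟩
  · refine NuclearOperator.closure_normAttainingNuclear_eq_univ hX fun n y ε hε => ?_
    obtain ⟨N, hfd, hN, hap⟩ := hY.exists_submodule y hε
    exact ⟨N, hN, hap, fun M _ φ _ => NuclearOperator.compactAtMax_of_finiteDimensional φ M N⟩
  · refine NuclearOperator.closure_normAttainingNuclear_eq_univ hX fun n y ε hε => ?_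
    -- Uniform convexity gives compactness on all of `Y`, so the identity serves as projection and
    -- the vectors need no approximation.
    refine ⟨⊤, ⟨ContinuousLinearMap.id 𝕜 Y, ContinuousLinearMap.norm_id_le, fun _ => trivial,
      fun _ _ => rfl⟩, ⟨y, fun _ => trivial, by simpa using fun _ => hε⟩, fun M _ φ hφ =>
      NuclearOperator.compactAtMax_of_uniformConvexSpace hφ M ⊤⟩
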